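/- For a non-negative integer $n$ let $J_n(z)=\sum_{k\ge 0}\frac{(-1)^k}{k!\,(k+n)!}\left(\frac z2\right)^{2k+n}$ be the Bessel function of the first kind. An entire function $f$ is said to be of exponential type $\tau$ if for every $\varepsilon>0$ the inequality $|f(z)|\le e^{(\tau+\varepsilon)|z|}$ holds for all $z\in\mathbb C$ with $|z|$ sufficiently large. Theorem 1. Let $f$ be an entire function of exponential type $\tau$ with $\int_0^\infty |f(x)|\,dx<\infty$, and suppose that $$f(z)=z^{2m+1}\sum_{j=0}^\infty a_j z^{2j}\qquad(z\in\mathbb C),$$ where $m\ge 0$ is an integer and $a_0\ne 0$ (so $f$ is odd). Let $l\ge 0$ be an integer and let $\lambda>\tau$ be real. Then $x\mapsto f(x)J_{2l}(\lambda x)$ is integrable on $(0,\infty)$, and $$\int_0^\infty f(x)J_{2l}(\lambda x)\,dx=0\qquad\text{if } l<m+1,$$ $$\int_0^\infty f(x)J_{2l}(\lambda x)\,dx=\frac12\sum_{j=0}^{l-m-1}a_j\,\frac{(l+m+j)!}{(l-m-j-1)!}\left(\frac2\lambda\right)^{2m+2j+2}\qquad\text{if } l\ge m+1.$$ Consequently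 the Poincaré asymptotic expansion $$\int_0^\infty f(x)J_{2l}(\lambda x)\,dx\sim\frac12\sum_{s=0}^\infty\frac{f^{(s)}(0)}{s!}\,\frac{\Gamma\left(\frac12(2l+s+1)\right)}{\Gamma\left(\frac12(2l-s+1)\right)}\left(\frac2\lambda\right)^{s+1}\qquad(\lambda\to\infty)$$ (with $1/\Gamma=0$ at the poles of $\Gamma$) terminates, all its terms with $s\ge 2l$ being zero, and for every $\lambda>\tau$ the integral equals the sum of the terms with $s<2l$, with no remainder. -/

import Mathlib

/-- `f` is an entire function of exponential type `τ`: it is holomorphic on all of `ℂ` and for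
every `ε > 0` the bound `|f z| ≤ exp ((τ + ε) |z|)` holds for all sufficiently large `|z|`. -/
def IsEntireOfExpType (f : ℂ → ℂ) (τ : ℝ) : Prop :=
  Differentiable ℂ f ∧
    ∀ ε : ℝ, 0 < ε → ∃ R : ℝ, ∀ z : ℂ, R ≤ ‖z‖ → ‖f z‖ ≤ Real.exp ((τ + ε) * ‖z‖)

/-- The `k`-th term of the power series of the Bessel function of the first kind of order `n`. -/
noncomputable def besselJTerm (n : ℕ) (z : ℂ) (k : ℕ) : ℂ :=
  (-1) ^ k / ((k.factorial : ℂ) * ((k + n).factorial : ℂ)) * (z / 2) ^ (2 * k + n)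

/-- The Bessel function of the first kind of order `n`,
`J_n(z) = ∑ k, (-1)^k / (k! (k+n)!) * (z/2)^(2k+n)`. -/
noncomputable def besselJ (n : ℕ) (z : ℂ) : ℂ :=
  ∑' k : ℕ, besselJTerm n z k

/-- The defining series of `J_n` converges at every complex number. -/
theorem summable_besselJTerm (n : ℕ) (z : ℂ) : Summable (besselJTerm n z) := by
  have h := (Real.summable_pow_div_factorial (‖z / 2‖ ^ 2)).mul_right (‖z / 2‖ ^ n)
  refine Summable.of_norm_bounded h (fun k => ?_)
  have h1 : (1 : ℝ) ≤ ((k + n).factorial : ℝ) := by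
    exact_mod_cast Nat.one_le_iff_ne_zero.mpr (Nat.factorial_ne_zero _)
  have h2 : (0 : ℝ) < (k.factorial : ℝ) := by exact_mod_cast Nat.factorial_pos k
  have h3 : ‖besselJTerm n z k‖ =
      (‖z / 2‖ ^ 2) ^ k * ‖z / 2‖ ^ n / ((k.factorial : ℝ) * ((k + n).factorial : ℝ)) := by
    unfold besselJTerm
    rw [norm_mul, norm_div, norm_mul, norm_pow, norm_pow, norm_neg, norm_one, one_pow,
      Complex.norm_natCast, Complex.norm_natCast, pow_add, pow_mul]
    ring
  rw [h3, div_mul_eq_mul_div]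
  apply div_le_div_of_nonneg_left (by positivity) h2
  nlinarith

/-- The Hankel transform `∫_0^∞ f(x) J_n(λ x) dx` of order `n` at the (real) parameter `lam`. -/
noncomputable def hankelTransform (n : ℕ) (f : ℂ → ℂ) (lam : ℝ) : ℂ :=
  ∫ x : ℝ in Set.Ioi 0, f (x : ℂ) * besselJ n ((lam : ℂ) * (x : ℂ))

/-- The `s`-th term of the Poincaré asymptotic expansion (as `lam → ∞`) of the Hankel transform
of order `n` of `f`, namely
`(1/2) (f^(s)(0) / s!) (Γ((n+s+1)/2) / Γ((n-s+1)/2)) (2/lam)^(s+1)`.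
The factor `1/Γ` is the entire function that vanishes at `0, -1, -2, …`; this agrees with
division by `Real.Gamma`, whose value at these points is `0`. -/
noncomputable def poincareTerm (n : ℕ) (f : ℂ → ℂ) (lam : ℝ) (s : ℕ) : ℂ :=
  (1 / 2) * (iteratedDeriv s f 0 / (s.factorial : ℂ)) *
    ((Real.Gamma (((n : ℝ) + s + 1) / 2) / Real.Gamma (((n : ℝ) - s + 1) / 2) : ℝ) : ℂ) *
    (2 / (lam : ℂ)) ^ (s + 1)

/-! By Bessel's integral and Fubini, the transform is, up to the factor `(-1)^l / (2π)`, the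
integral over a period of `G(λ cos θ) cos(2lθ)`, where `G(t) = ∫_0^∞ f(x) e^{itx} dx`
(`hankelTransform_eq_integral`). The function `G` is holomorphic in the upper half-plane and
continuous up to the real axis. Where `|t| > ρ`, for a `ρ` between `max τ 0` and `λ`, it equals the
Borel series `∑ f^(n)(0) (i/t)^(n+1)` (`halfFourier_eq_borelSeries`), which is even in `t` because
`f` is odd.

Put `t = λ(u + 1/u)/2`. The lower half of the unit disc goes to the upper half-plane. Take `G(t)` on
the lower half-disc and `G(-t)` on the upper one. Across the real diameter `|t| ≥ λ > ρ`, so both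
are the same even Borel series and they glue to a function `K`, holomorphic in the disc and
continuous on its closure, with `K(0) = 0` (`diffContOnCl_discTransform`). On the circle `t = λ cos
θ`, so the integral of `G(λ cos θ) cos(2lθ)` is `π` times the Taylor coefficient of `K` of order
`2l` (`integral_halfFourier_cos`). Since `t^(-2p-2)` starts at `u^(2p+2)`, only `p < l` contributes:
the coefficient is a finite sum, which is why the expansion terminates without remainder. -/

open Complex MeasureTheory Filter Topology Set Metric

/-! ### Power series and Fourier coefficients on the unit circle -/

/-- Coefficients of a convergent power series are determined by its sum near `0`. -/
theorem coeff_eq_of_eventually_hasSum {F : ℂ → ℂ} {c d : ℕ → ℂ}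
    (hc : ∀ᶠ z in 𝓝 0, HasSum (fun n => c n * z ^ n) (F z))
    (hd : ∀ᶠ z in 𝓝 0, HasSum (fun n => d n * z ^ n) (F z)) : c = d := by
  have key : ∀ e : ℕ → ℂ, (∀ᶠ z in 𝓝 0, HasSum (fun n => e n * z ^ n) (F z)) →
      HasFPowerSeriesAt F (FormalMultilinearSeries.ofScalars ℂ e) 0 := by
    intro e he
    rw [hasFPowerSeriesAt_iff]
    filter_upwards [he] with z hz
    simpa [FormalMultilinearSeries.coeff_ofScalars, mul_comm] using hz
  have h := (key c hc).eq_formalMultilinearSeries (key d hd)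
  funext n
  have h2 := congrArg (fun p => FormalMultilinearSeries.coeff p n) h
  simpa only [FormalMultilinearSeries.coeff_ofScalars] using h2

/-- Fill a series with sparse exponents by zero coefficients. -/
theorem hasSum_extend_pow {e : ℕ → ℕ} (he : Function.Injective e) {c : ℕ → ℂ} {z S : ℂ}
    (h : HasSum (fun j => c j * z ^ e j) S) :
    HasSum (fun n => Function.extend e c 0 n * z ^ n) S := by
  rw [← he.hasSum_iff]
  · have hfun : (fun n => Function.extend e c 0 n * z ^ n) ∘ e = fun j => c j * z ^ e j := by
      funext j
      simp [he.extend_apply]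
    rw [hfun]
    exact h
  · intro n hn
    rw [Function.extend_apply' _ _ _ (by simpa using hn)]
    simp

/-- Taylor coefficients as Fourier coefficients of the boundary values on the unit circle. -/
theorem integral_circle_eq_coeff {F : ℂ → ℂ} (hF : DiffContOnCl ℂ F (ball 0 1)) {c : ℕ → ℂ}
    (hc : ∀ᶠ z in 𝓝 0, HasSum (fun n => c n * z ^ n) (F z)) (n : ℕ) :
    ∫ θ in (0 : ℝ)..2 * Real.pi, F (cexp (θ * I)) * cexp (-(n * θ * I)) = 2 * Real.pi * c n := by
  have h1 := (DiffContOnCl.hasFPowerSeriesOnBall (R := 1) (by simpa using hF) one_pos)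
  have h2 := hasFPowerSeriesAt_iff.1 h1.hasFPowerSeriesAt
  have h3 : (fun n => (cauchyPowerSeries F 0 (1 : NNReal)).coeff n) = c := by
    refine coeff_eq_of_eventually_hasSum (F := F) ?_ hc
    filter_upwards [h2] with z hz
    simpa [mul_comm] using hz
  have h4 := congrFun h3 n
  rw [← h4]
  change _ = _ * (cauchyPowerSeries F 0 (1 : NNReal) n fun _ => 1)
  rw [cauchyPowerSeries_apply, circleIntegral]
  have h5 : (∫ θ in (0 : ℝ)..2 * Real.pi, deriv (circleMap 0 ((1 : NNReal) : ℝ)) θ •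
      (fun z : ℂ => (1 / (z - 0)) ^ n • (z - 0)⁻¹ • F z) (circleMap 0 ((1 : NNReal) : ℝ) θ)) =
      ∫ θ in (0 : ℝ)..2 * Real.pi, I * (F (cexp (θ * I)) * cexp (-(n * θ * I))) := by
    congr 1
    funext θ
    have : cexp (-(n * θ * I)) = (cexp (θ * I))⁻¹ ^ n := by
      rw [← Complex.exp_neg, ← Complex.exp_nat_mul]
      ring_nf
    have h0 := Complex.exp_ne_zero (θ * I)
    simp only [deriv_circleMap, circleMap, this, smul_eq_mul]
    simp
    field_simp
  rw [h5, intervalIntegral.integral_const_mul]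
  have hpi : (Real.pi : ℂ) ≠ 0 := by exact_mod_cast Real.pi_ne_zero
  have hI := I_ne_zero
  generalize (∫ θ in (0 : ℝ)..2 * Real.pi, F (cexp (θ * I)) * cexp (-(n * θ * I))) = A
  simp only [smul_eq_mul]
  field_simp

/-- The mean value property for `F z * z ^ n`. -/
theorem integral_circle_mul_pow {F : ℂ → ℂ} (hF : DiffContOnCl ℂ F (ball 0 1))
    (n : ℕ) (h0 : F 0 = 0) :
    ∫ θ in (0 : ℝ)..2 * Real.pi, F (cexp (θ * I)) * cexp (n * θ * I) = 0 := by
  have h1 : DiffContOnCl ℂ (fun z => z ^ n • F z) (ball 0 1) :=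
    (Differentiable.diffContOnCl (by fun_prop)).smul hF
  -- The value at the centre is `0 ^ n * F 0`; the hypothesis `F 0 = 0` matters only when `n = 0`.
  have h2 := h1.circleIntegral_sub_inv_smul (mem_ball_self one_pos)
  simp only [h0, smul_zero, circleIntegral] at h2
  have h5 : (∫ θ in (0 : ℝ)..2 * Real.pi, deriv (circleMap 0 1) θ •
      ((circleMap 0 1 θ - 0)⁻¹ • (circleMap 0 1 θ) ^ n • F (circleMap 0 1 θ))) =
      ∫ θ in (0 : ℝ)..2 * Real.pi, I * (F (cexp (θ * I)) * cexp (n * θ * I)) := by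
    congr 1
    funext θ
    have : cexp (n * θ * I) = (cexp (θ * I)) ^ n := by
      rw [← Complex.exp_nat_mul]
      ring_nf
    have h0 := Complex.exp_ne_zero (θ * I)
    simp only [deriv_circleMap, circleMap, this, smul_eq_mul]
    simp
    field_simp
  rw [h5, intervalIntegral.integral_const_mul] at h2
  simpa using h2

/-! ### Bessel's integral -/

theorem integral_circle_exp (c : ℂ) (n : ℕ) :
    ∫ θ in (0 : ℝ)..2 * Real.pi, cexp (c * cexp (θ * I)) * cexp (-(n * θ * I)) =
      2 * Real.pi * (c ^ n / n.factorial) := by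
  refine integral_circle_eq_coeff (F := fun z => cexp (c * z))
    (Differentiable.diffContOnCl (by fun_prop)) (c := fun n => c ^ n / n.factorial) ?_ n
  refine Eventually.of_forall fun z => ?_
  have := NormedSpace.expSeries_div_hasSum_exp (c * z)
  rw [← Complex.exp_eq_exp_ℂ] at this
  have hfun : (fun n : ℕ => c ^ n / n.factorial * z ^ n) =
      fun n : ℕ => (c * z) ^ n / n.factorial := by
    funext k
    rw [mul_pow]; ring
  rw [hfun]
  exact this

/-- Bessel's integral. -/
theorem integral_exp_cos_mul_exp (n : ℕ) (z : ℂ) :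
    ∫ θ in (0 : ℝ)..2 * Real.pi, cexp (I * z * Real.cos θ) * cexp (-(n * θ * I)) =
      2 * Real.pi * (I ^ n * besselJ n z) := by
  -- With `2 cos θ = e^{iθ} + e^{-iθ}` the exponential factors. Only the factor in `e^{-iθ}` is
  -- expanded; the other stays closed, so the `k`-th integral is its Taylor coefficient of order `n
  -- + k`.
  have hs := intervalIntegral.hasSum_integral_of_dominated_convergence (μ := volume)
    (a := 0) (b := 2 * Real.pi)
    (F := fun (k : ℕ) (θ : ℝ) => (I * z / 2) ^ k / k.factorial *
      (cexp (I * z / 2 * cexp (θ * I)) * cexp (-((n + k : ℕ) * θ * I))))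
    (f := fun θ : ℝ => cexp (I * z * Real.cos θ) * cexp (-(n * θ * I)))
    (fun k _ => (‖z‖ / 2) ^ k / k.factorial * Real.exp (‖z‖ / 2)) ?_ ?_ ?_ ?_ ?_
  · have ht : HasSum (fun k => 2 * Real.pi * (I ^ n * besselJTerm n z k))
        (2 * Real.pi * (I ^ n * besselJ n z)) :=
      ((summable_besselJTerm n z).hasSum.mul_left _).mul_left _
    refine hs.unique ?_
    have hfun : (fun k : ℕ => ∫ θ in (0 : ℝ)..2 * Real.pi, (I * z / 2) ^ k / k.factorial *
      (cexp (I * z / 2 * cexp (θ * I)) * cexp (-((n + k : ℕ) * θ * I)))) =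
        fun k => 2 * Real.pi * (I ^ n * besselJTerm n z k) := by
      funext k
      rw [intervalIntegral.integral_const_mul, integral_circle_exp, besselJTerm, mul_div_assoc,
        mul_pow, mul_pow, show (-1 : ℂ) ^ k = I ^ k * I ^ k by rw [← mul_pow, I_mul_I],
        Nat.add_comm n k]
      have h1 : (k.factorial : ℂ) ≠ 0 := by exact_mod_cast k.factorial_ne_zero
      have h2 : ((k + n).factorial : ℂ) ≠ 0 := by exact_mod_cast (k + n).factorial_ne_zero
      field_simp
      ring
    rw [hfun]
    exact ht
  · intro k
    exact Continuous.aestronglyMeasurable (by fun_prop)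
  · intro k
    refine Eventually.of_forall fun θ _ => ?_
    have e1 : ‖cexp (-((n + k : ℕ) * θ * I))‖ = 1 := by
      rw [Complex.norm_exp]; simp
    have e2 : ‖cexp (I * z / 2 * cexp (θ * I))‖ ≤ Real.exp (‖z‖ / 2) := by
      refine (Complex.norm_exp_le_exp_norm _).trans (Real.exp_le_exp.2 ?_)
      simp [Complex.norm_exp]
    rw [norm_mul, norm_mul, e1, mul_one]
    simp only [norm_div, norm_pow, norm_mul, norm_I, one_mul, Complex.norm_natCast,
      Complex.norm_ofNat]
    gcongr
  · exact Eventually.of_forall fun θ _ => (Real.summable_pow_div_factorial _).mul_right _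
  · exact intervalIntegrable_const
  · refine Eventually.of_forall fun θ _ => ?_
    have h := NormedSpace.expSeries_div_hasSum_exp (I * z / 2 * cexp (-(θ * I)))
    rw [← Complex.exp_eq_exp_ℂ] at h
    have h' := h.mul_right (cexp (I * z / 2 * cexp (θ * I)) * cexp (-(n * θ * I)))
    have hfun : (fun k : ℕ => (I * z / 2) ^ k / k.factorial *
        (cexp (I * z / 2 * cexp (θ * I)) * cexp (-((n + k : ℕ) * θ * I)))) =
        fun k : ℕ => (I * z / 2 * cexp (-(θ * I))) ^ k / k.factorial *
          (cexp (I * z / 2 * cexp (θ * I)) * cexp (-(n * θ * I))) := by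
      funext k
      have : cexp (-((n + k : ℕ) * θ * I)) = cexp (-(θ * I)) ^ k * cexp (-(n * θ * I)) := by
        rw [← Complex.exp_nat_mul, ← Complex.exp_add]
        push_cast; ring_nf
      rw [this, mul_pow]; ring
    have hv : cexp (I * z * Real.cos θ) * cexp (-(n * θ * I)) =
        cexp (I * z / 2 * cexp (-(θ * I))) *
          (cexp (I * z / 2 * cexp (θ * I)) * cexp (-(n * θ * I))) := by
      have he : I * z * Real.cos θ =
          I * z / 2 * cexp (-(θ * I)) + I * z / 2 * cexp (θ * I) := by
        rw [Complex.ofReal_cos, Complex.cos]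
        ring_nf
      rw [he, Complex.exp_add, mul_assoc]
    rw [hfun, hv]
    exact h'

/-- `2π - θ` substitution. -/
theorem integral_comp_two_pi_sub (A : ℝ → ℂ) (a b : ℝ) :
    ∫ θ in a..b, A (2 * Real.pi - θ) = ∫ θ in (2 * Real.pi - b)..(2 * Real.pi - a), A θ :=
  intervalIntegral.integral_comp_sub_left A _

/-- The substitution `θ ↦ 2π - θ` fixes `cos θ` and exchanges the frequencies `n` and `-n`, so both
give the same integral and may be averaged. -/
theorem integral_exp_cos_mul_cos (n : ℕ) (z : ℂ) :
    ∫ θ in (0 : ℝ)..2 * Real.pi, cexp (I * z * Real.cos θ) * Real.cos (n * θ) =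
      2 * Real.pi * (I ^ n * besselJ n z) := by
  have h1 := integral_exp_cos_mul_exp n z
  have h2 : ∫ θ in (0 : ℝ)..2 * Real.pi, cexp (I * z * Real.cos θ) * cexp (n * θ * I) =
      2 * Real.pi * (I ^ n * besselJ n z) := by
    rw [← h1]
    have := integral_comp_two_pi_sub
      (fun θ : ℝ => cexp (I * z * Real.cos θ) * cexp (n * θ * I)) 0 (2 * Real.pi)
    simp only [sub_self, sub_zero] at this
    rw [← this]
    congr 1
    funext θ
    rw [Real.cos_two_pi_sub]
    congr 1
    have : (n : ℂ) * ((2 * Real.pi - θ : ℝ) : ℂ) * I = -(n * θ * I) + n * (2 * Real.pi * I) := by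
      push_cast; ring
    rw [this, Complex.exp_add, Complex.exp_nat_mul_two_pi_mul_I, mul_one]
  have h3 : ∀ θ : ℝ, cexp (I * z * Real.cos θ) * (Real.cos (n * θ) : ℂ) =
      (1 / 2) * (cexp (I * z * Real.cos θ) * cexp (-(n * θ * I)) +
        cexp (I * z * Real.cos θ) * cexp (n * θ * I)) := by
    intro θ
    rw [Complex.ofReal_cos (n * θ), Complex.cos]
    push_cast
    ring_nf
  simp_rw [h3]
  rw [intervalIntegral.integral_const_mul, intervalIntegral.integral_add, h1, h2]
  · ring
  all_goals exact Continuous.intervalIntegrable (by fun_prop) _ _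

/-! ### The one-sided Fourier transform in the upper half-plane -/

/-- The one-sided Fourier transform, for a complex frequency in the closed upper half-plane. -/
noncomputable def halfFourier (g : ℝ → ℂ) (t : ℂ) : ℂ :=
  ∫ x : ℝ in Ioi 0, g x * cexp (I * t * x)

theorem norm_exp_I_mul_mul_ofReal (t : ℂ) (x : ℝ) :
    ‖cexp (I * t * x)‖ = Real.exp (-(t.im * x)) := by
  rw [Complex.norm_exp]
  simp

/-- The kernel has modulus at most `1` for `0 ≤ t.im`, so `‖g‖` dominates. Including the real axis
is essential, since the path `λ cos θ` lies there. -/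
theorem continuousOn_halfFourier {g : ℝ → ℂ} (hg : IntegrableOn g (Ioi 0)) :
    ContinuousOn (halfFourier g) {t : ℂ | 0 ≤ t.im} := by
  refine continuousOn_of_dominated (bound := fun x => ‖g x‖) ?_ ?_ hg.norm ?_
  · intro t _
    exact hg.aestronglyMeasurable.mul (Continuous.aestronglyMeasurable (by fun_prop))
  · intro t ht
    filter_upwards [ae_restrict_mem measurableSet_Ioi] with x hx
    rw [norm_mul, norm_exp_I_mul_mul_ofReal]
    refine mul_le_of_le_one_right (norm_nonneg _) (Real.exp_le_one_iff.2 ?_)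
    have ht : 0 ≤ t.im := ht
    have hx : 0 < x := hx
    have := mul_nonneg ht hx.le
    linarith
  · exact Eventually.of_forall fun x => Continuous.continuousOn (by fun_prop)

theorem differentiableAt_halfFourier {g : ℝ → ℂ} (hg : IntegrableOn g (Ioi 0)) {t : ℂ}
    (ht : 0 < t.im) : DifferentiableAt ℂ (halfFourier g) t := by
  have hopen : IsOpen {s : ℂ | t.im / 2 < s.im} := isOpen_lt continuous_const continuous_im
  have hmem : {s : ℂ | t.im / 2 < s.im} ∈ 𝓝 t := hopen.mem_nhds (by simp; linarith)
  have hmeas : ∀ s : ℂ, AEStronglyMeasurable (fun x : ℝ => g x * cexp (I * s * x))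
      (volume.restrict (Ioi 0)) := fun s =>
    hg.aestronglyMeasurable.mul (Continuous.aestronglyMeasurable (by fun_prop))
  refine (hasDerivAt_integral_of_dominated_loc_of_deriv_le (μ := volume.restrict (Ioi 0))
    (F := fun s (x : ℝ) => g x * cexp (I * s * x))
    (F' := fun s (x : ℝ) => g x * (cexp (I * s * x) * (I * x)))
    (bound := fun x => ‖g x‖ * (2 / t.im)) hmem (Eventually.of_forall hmeas) ?_ ?_ ?_ ?_
    ?_).2.differentiableAt
  · refine hg.norm.mono' (hmeas t) ?_
    filter_upwards [ae_restrict_mem measurableSet_Ioi] with x hx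
    rw [norm_mul, norm_exp_I_mul_mul_ofReal]
    refine mul_le_of_le_one_right (norm_nonneg _) (Real.exp_le_one_iff.2 ?_)
    have := mul_nonneg ht.le (le_of_lt hx)
    linarith
  · exact hg.aestronglyMeasurable.mul (Continuous.aestronglyMeasurable (by fun_prop))
  · filter_upwards [ae_restrict_mem measurableSet_Ioi] with x hx s hs
    have hx : 0 < x := hx
    have hs : t.im / 2 < s.im := hs
    rw [norm_mul, norm_mul, norm_exp_I_mul_mul_ofReal]
    gcongr
    simp only [norm_mul, norm_I, one_mul, Complex.norm_real, Real.norm_eq_abs, abs_of_pos hx]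
    -- The bound `x e^{-x Im s} ≤ 2 / Im t` follows from `1 + y ≤ e^y` and `Im s > Im t / 2`.
    rw [Real.exp_neg, inv_mul_le_iff₀ (Real.exp_pos _)]
    have h1 := Real.add_one_le_exp (s.im * x)
    have h2 : x ≤ (s.im * x) * (2 / t.im) := by
      rw [mul_div_assoc', le_div_iff₀ ht]
      nlinarith
    have h3 : 0 ≤ 2 / t.im := by positivity
    nlinarith
  · exact hg.norm.mul_const _
  · refine Eventually.of_forall fun x s _ => ?_
    have h : HasDerivAt (fun s : ℂ => I * s * x) (I * x) s := by
      simpa using ((hasDerivAt_id s).const_mul I).mul_const (x : ℂ)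
    exact h.cexp.const_mul _

/-! ### Laplace integrals and derivatives at the origin -/

theorem integrableOn_pow_mul_exp_neg (n : ℕ) {y : ℝ} (hy : 0 < y) :
    IntegrableOn (fun x : ℝ => x ^ n * Real.exp (-(y * x))) (Ioi 0) := by
  have h := integrableOn_rpow_mul_exp_neg_mul_rpow (p := 1) (s := n) (b := y)
    (by have : (0 : ℝ) ≤ n := n.cast_nonneg
        linarith) one_pos hy
  simpa using h

theorem integral_pow_mul_exp_neg (n : ℕ) {y : ℝ} (hy : 0 < y) :
    ∫ x : ℝ in Ioi 0, x ^ n * Real.exp (-(y * x)) = n.factorial / y ^ (n + 1) := by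
  have h := Real.integral_rpow_mul_exp_neg_mul_Ioi (a := n + 1) (by positivity) hy
  rw [Real.Gamma_nat_eq_factorial] at h
  simp only [add_sub_cancel_right, Real.rpow_natCast] at h
  rw [h]
  have : (1 / y) ^ ((n : ℝ) + 1) = (1 / y) ^ (n + 1) := by
    exact_mod_cast Real.rpow_natCast (1 / y) (n + 1)
  rw [this, one_div, inv_pow]
  field_simp

/-- Derivatives at `0` of an entire function of exponential type. -/
theorem norm_iteratedDeriv_zero_le {f : ℂ → ℂ} (hf : Differentiable ℂ f) {C σ ρ : ℝ}
    (hb : ∀ z, ‖f z‖ ≤ C * Real.exp (σ * ‖z‖)) (hσ : σ < ρ) (hρ : 0 < ρ) (n : ℕ) :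
    ‖iteratedDeriv n f 0‖ ≤ C / (ρ - σ) * ρ ^ (n + 1) := by
  -- Cauchy's estimate on each circle of radius `r` is weighted by `e^{-ρr}` and then integrated
  -- over `r`. The factor `n!` appears on both sides and cancels, so no optimal radius has to be
  -- chosen.
  have h1 : ∀ r : ℝ, 0 < r → ‖iteratedDeriv n f 0‖ * (r ^ n * Real.exp (-(ρ * r))) ≤
      n.factorial * C * (r ^ 0 * Real.exp (-((ρ - σ) * r))) := by
    intro r hr
    have h2 := norm_iteratedDeriv_le_of_forall_mem_sphere_norm_le (c := 0) n hr hf.diffContOnCl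
      (C := C * Real.exp (σ * r)) (fun z hz => by
        have := hb z
        rwa [mem_sphere_zero_iff_norm.1 hz] at this)
    rw [le_div_iff₀ (by positivity)] at h2
    have h3 : Real.exp (-((ρ - σ) * r)) = Real.exp (σ * r) * Real.exp (-(ρ * r)) := by
      rw [← Real.exp_add]; ring_nf
    calc _ = ‖iteratedDeriv n f 0‖ * r ^ n * Real.exp (-(ρ * r)) := by ring
      _ ≤ n.factorial * (C * Real.exp (σ * r)) * Real.exp (-(ρ * r)) := by gcongr
      _ = _ := by rw [h3]; ring
  have h2 := setIntegral_mono_on (((integrableOn_pow_mul_exp_neg n hρ)).const_mul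
      ‖iteratedDeriv n f 0‖) ((integrableOn_pow_mul_exp_neg 0 (sub_pos.2 hσ)).const_mul
      (n.factorial * C)) measurableSet_Ioi (fun r hr => h1 r hr)
  rw [integral_const_mul, integral_const_mul, integral_pow_mul_exp_neg _ hρ,
    integral_pow_mul_exp_neg _ (sub_pos.2 hσ)] at h2
  have h3 : 0 < ρ - σ := sub_pos.2 hσ
  have h4 : (0 : ℝ) < n.factorial := by positivity
  rw [← mul_div_assoc, div_le_iff₀ (by positivity)] at h2
  refine le_of_mul_le_mul_right ?_ h4
  calc _ ≤ _ := h2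
    _ = _ := by simp; field_simp

/-- The Laplace transform along the positive imaginary axis, expanded term by term. -/
theorem hasSum_halfFourier_I_mul {f : ℂ → ℂ} (hf : Differentiable ℂ f) {M ρ y : ℝ}
    (hD : ∀ n, ‖iteratedDeriv n f 0‖ ≤ M * ρ ^ (n + 1)) (hρ : 0 < ρ) (hy : ρ < y) :
    HasSum (fun n => iteratedDeriv n f 0 * (1 / (y : ℂ)) ^ (n + 1))
      (halfFourier (fun x => f x) (I * y)) := by
  have hy0 : 0 < y := hρ.trans hy
  have hint : ∀ n : ℕ, IntegrableOn (fun x : ℝ =>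
      (iteratedDeriv n f 0 / n.factorial) * ((x ^ n * Real.exp (-(y * x)) : ℝ) : ℂ)) (Ioi 0) :=
    fun n => ((integrableOn_pow_mul_exp_neg n hy0).ofReal).const_mul _
  have hval : ∀ n : ℕ, ∫ x : ℝ in Ioi 0, (iteratedDeriv n f 0 / n.factorial) *
      ((x ^ n * Real.exp (-(y * x)) : ℝ) : ℂ) =
        iteratedDeriv n f 0 * (1 / (y : ℂ)) ^ (n + 1) := by
    intro n
    rw [integral_const_mul, integral_complex_ofReal, integral_pow_mul_exp_neg n hy0]
    have : (n.factorial : ℂ) ≠ 0 := by exact_mod_cast n.factorial_ne_zero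
    push_cast
    rw [one_div, inv_pow]
    field_simp
  have hnorm : ∀ n : ℕ, ∫ x : ℝ in Ioi 0, ‖(iteratedDeriv n f 0 / n.factorial) *
      ((x ^ n * Real.exp (-(y * x)) : ℝ) : ℂ)‖ = ‖iteratedDeriv n f 0‖ / y ^ (n + 1) := by
    intro n
    have : ∀ x ∈ Ioi (0 : ℝ), ‖(iteratedDeriv n f 0 / n.factorial) *
      ((x ^ n * Real.exp (-(y * x)) : ℝ) : ℂ)‖ =
        ‖iteratedDeriv n f 0‖ / n.factorial * (x ^ n * Real.exp (-(y * x))) := by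
      intro x hx
      have hx : 0 < x := hx
      rw [norm_mul, norm_div, Complex.norm_natCast, Complex.norm_real, Real.norm_eq_abs,
        abs_of_nonneg (by positivity)]
    rw [setIntegral_congr_fun measurableSet_Ioi this, integral_const_mul,
      integral_pow_mul_exp_neg n hy0]
    field_simp
  -- Since `ρ < y`, a geometric series of ratio `ρ / y` dominates, which justifies termwise
  -- integration.
  have hsum : Summable fun n : ℕ => ∫ x : ℝ in Ioi 0, ‖(iteratedDeriv n f 0 / n.factorial) *
      ((x ^ n * Real.exp (-(y * x)) : ℝ) : ℂ)‖ := by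
    simp_rw [hnorm]
    have hg : Summable fun n : ℕ => M * (ρ / y) * (ρ / y) ^ n :=
      (summable_geometric_of_lt_one (by positivity) ((div_lt_one hy0).2 hy)).mul_left _
    refine Summable.of_nonneg_of_le (fun n => by positivity) (fun n => ?_) hg
    rw [div_le_iff₀ (by positivity)]
    refine (hD n).trans (le_of_eq ?_)
    rw [div_pow, pow_succ ρ, pow_succ y]
    field_simp
  have h := hasSum_integral_of_summable_integral_norm hint hsum
  simp_rw [hval] at h
  have hres : ∫ x : ℝ in Ioi 0, ∑' n : ℕ, (iteratedDeriv n f 0 / n.factorial) *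
      ((x ^ n * Real.exp (-(y * x)) : ℝ) : ℂ) = halfFourier (fun x => f x) (I * y) := by
    refine setIntegral_congr_fun measurableSet_Ioi fun x _ => ?_
    have ht := (Complex.hasSum_taylorSeries_of_entire hf 0 x).mul_right (cexp (I * (I * y) * x))
    rw [← ht.tsum_eq]
    congr 1
    funext n
    have : I * (I * y) * x = ((-(y * x) : ℝ) : ℂ) := by
      rw [← mul_assoc, I_mul_I]; push_cast; ring
    rw [this]
    push_cast
    simp only [smul_eq_mul, sub_zero]
    ring
  rwa [hres] at h

/-! ### The Borel transform and its identification with the Fourier transform -/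

/-- The Borel transform in the variable `v = 1 / t`. -/
noncomputable def borelSeries (D : ℕ → ℂ) (v : ℂ) : ℂ :=
  ∑' n : ℕ, D n * (I * v) ^ (n + 1)

theorem summable_norm_borelSeries {D : ℕ → ℂ} {M ρ : ℝ} (hD : ∀ n, ‖D n‖ ≤ M * ρ ^ (n + 1))
    (hρ : 0 < ρ) {v : ℂ} (hv : ρ * ‖v‖ < 1) :
    Summable fun n : ℕ => ‖D n * (I * v) ^ (n + 1)‖ := by
  have hg : Summable fun n : ℕ => M * (ρ * ‖v‖) * (ρ * ‖v‖) ^ n :=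
    (summable_geometric_of_lt_one (by positivity) hv).mul_left _
  refine Summable.of_nonneg_of_le (fun n => norm_nonneg _) (fun n => ?_) hg
  rw [norm_mul, norm_pow, norm_mul, norm_I, one_mul]
  calc _ ≤ M * ρ ^ (n + 1) * ‖v‖ ^ (n + 1) := by gcongr; exact hD n
    _ = _ := by rw [mul_pow, pow_succ, pow_succ]; ring

theorem differentiableOn_borelSeries {D : ℕ → ℂ} {M ρ : ℝ} (hD : ∀ n, ‖D n‖ ≤ M * ρ ^ (n + 1))
    (hρ : 0 < ρ) : DifferentiableOn ℂ (borelSeries D) {v | ρ * ‖v‖ < 1} := by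
  intro v hv
  obtain ⟨r, hr1, hr2⟩ := exists_between (show ‖v‖ < 1 / ρ by
    rw [lt_div_iff₀ hρ, mul_comm]; exact hv)
  have hr0 : 0 < r := (norm_nonneg v).trans_lt hr1
  have hr3 : ρ * r < 1 := by rwa [lt_div_iff₀ hρ, mul_comm] at hr2
  have hg : Summable fun n : ℕ => M * (ρ * r) * (ρ * r) ^ n :=
    (summable_geometric_of_lt_one (by positivity) hr3).mul_left _
  have h := Complex.differentiableOn_tsum_of_summable_norm (U := ball 0 r)
    (F := fun n w => D n * (I * w) ^ (n + 1)) hg (fun n => by fun_prop) isOpen_ball ?_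
  · exact (h.differentiableAt (isOpen_ball.mem_nhds (by simpa using hr1))).differentiableWithinAt
  · intro n w hw
    have hw : ‖w‖ < r := by simpa using hw
    rw [norm_mul, norm_pow, norm_mul, norm_I, one_mul]
    have hM : 0 ≤ M * ρ ^ (n + 1) := (norm_nonneg _).trans (hD n)
    calc _ ≤ M * ρ ^ (n + 1) * r ^ (n + 1) := by gcongr; exact hD n
      _ = _ := by rw [mul_pow, pow_succ, pow_succ]; ring

/-- This evenness is what oddness of `f` provides, and it makes the gluing across the diameter of
the disc possible. -/
theorem borelSeries_neg {D : ℕ → ℂ} (hD : ∀ n, Even n → D n = 0) (v : ℂ) :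
    borelSeries D (-v) = borelSeries D v := by
  unfold borelSeries
  congr 1
  funext n
  rcases Nat.even_or_odd n with h | h
  · simp [hD n h]
  · rw [mul_neg, (show Even (n + 1) from h.add_one).neg_pow]

theorem borelSeries_zero (D : ℕ → ℂ) : borelSeries D 0 = 0 := by
  simp [borelSeries]

/-- Outside a disc the half-line Fourier transform of an entire function of exponential type is
given by the Borel transform, up to the boundary. -/
theorem halfFourier_eq_borelSeries {f : ℂ → ℂ} (hf : Differentiable ℂ f)
    (hint : IntegrableOn (fun x : ℝ => f x) (Ioi 0)) {M ρ : ℝ}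
    (hD : ∀ n, ‖iteratedDeriv n f 0‖ ≤ M * ρ ^ (n + 1)) (hρ : 0 < ρ) {t : ℂ} (ht : 0 ≤ t.im)
    (htρ : ρ < ‖t‖) :
    halfFourier (fun x => f x) t = borelSeries (fun n => iteratedDeriv n f 0) (t⁻¹) := by
  set G := halfFourier (fun x : ℝ => f x) with hG
  set b := borelSeries (fun n => iteratedDeriv n f 0) with hb
  have hbdiff := differentiableOn_borelSeries hD hρ
  have hVopen : IsOpen {v : ℂ | ρ * ‖v‖ < 1} := isOpen_lt (by fun_prop) continuous_const
  have hinv : ∀ t : ℂ, ρ < ‖t‖ → DifferentiableAt ℂ (fun t => b t⁻¹) t := by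
    intro t ht
    have ht0 : t ≠ 0 := norm_pos_iff.1 (hρ.trans ht)
    refine DifferentiableAt.comp t (hbdiff.differentiableAt (hVopen.mem_nhds ?_))
      (differentiableAt_inv ht0)
    simp only [mem_ofPred_eq, norm_inv]
    rwa [mul_inv_lt_iff₀ (hρ.trans ht), one_mul]
  have hopen : ∀ t : ℂ, 0 < t.im → ρ < ‖t‖ → G t = b t⁻¹ := by
    -- The exponential maps this convex half-strip onto the part of the upper half-plane with `|t| >
    -- ρ`, so connectedness comes for free.
    set S : Set ℂ := {z | Real.log ρ < z.re ∧ 0 < z.im ∧ z.im < Real.pi} with hS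
    have hSo : IsOpen S := (isOpen_lt continuous_const continuous_re).inter
      ((isOpen_lt continuous_const continuous_im).inter (isOpen_lt continuous_im continuous_const))
    have hSc : Convex ℝ S := (convex_halfSpace_re_gt _).inter
      ((convex_halfSpace_im_gt _).inter (convex_halfSpace_im_lt _))
    have him : ∀ z ∈ S, 0 < (cexp z).im := fun z hz => by
      rw [Complex.exp_im]
      exact mul_pos (Real.exp_pos _) (Real.sin_pos_of_pos_of_lt_pi hz.2.1 hz.2.2)
    have hnm : ∀ z ∈ S, ρ < ‖cexp z‖ := fun z hz => by
      rw [Complex.norm_exp]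
      exact (Real.log_lt_iff_lt_exp hρ).1 hz.1
    have h1 : AnalyticOnNhd ℂ (fun z => G (cexp z)) S :=
      DifferentiableOn.analyticOnNhd (fun z hz => ((differentiableAt_halfFourier hint
        (him z hz)).comp z Complex.differentiableAt_exp).differentiableWithinAt) hSo
    have h2 : AnalyticOnNhd ℂ (fun z => b (cexp z)⁻¹) S :=
      DifferentiableOn.analyticOnNhd (fun z hz => ((hinv _ (hnm z hz)).comp z
        Complex.differentiableAt_exp).differentiableWithinAt) hSo
    set x₀ : ℝ := Real.log ρ + 1
    -- The midline of the strip is the ray `t = iy` with `y > ρ`, where the Laplace integral was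
    -- expanded term by term; the identity theorem spreads the equality from there.
    have hline : ∀ x : ℝ, Real.log ρ < x →
        G (cexp (x + Real.pi / 2 * I)) = b (cexp (x + Real.pi / 2 * I))⁻¹ := by
      intro x hx
      have hx' : ρ < Real.exp x := (Real.log_lt_iff_lt_exp hρ).1 hx
      have he : cexp (x + Real.pi / 2 * I) = I * (Real.exp x : ℝ) := by
        rw [Complex.exp_add, Complex.exp_pi_div_two_mul_I]; push_cast; ring
      rw [he, hG, ← (hasSum_halfFourier_I_mul hf hD hρ hx').tsum_eq, hb, borelSeries]
      congr 1
      funext n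
      rw [mul_inv, ← mul_assoc, mul_inv_cancel₀ I_ne_zero, one_mul, one_div]
    have hz₀ : (x₀ + Real.pi / 2 * I : ℂ) ∈ S := by
      have := Real.pi_pos
      refine ⟨?_, ?_, ?_⟩ <;> simp [x₀] <;> linarith
    have hEq := h1.eqOn_of_preconnected_of_frequently_eq h2 hSc.isPreconnected hz₀ (by
      have htend : Tendsto (fun x : ℝ => (x + Real.pi / 2 * I : ℂ)) (𝓝[≠] x₀)
          (𝓝[≠] (x₀ + Real.pi / 2 * I : ℂ)) := by
        refine tendsto_nhdsWithin_of_tendsto_nhds_of_eventually_within _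
          (Tendsto.mono_left (Continuous.tendsto (by fun_prop) _) nhdsWithin_le_nhds) ?_
        filter_upwards [self_mem_nhdsWithin] with x hx
        simpa using hx
      refine htend.frequently (Eventually.frequently ?_)
      filter_upwards [nhdsWithin_le_nhds (lt_mem_nhds (show Real.log ρ < x₀ by simp [x₀]))] with x hx
      exact hline x hx)
    intro t ht htρ
    have ht0 : t ≠ 0 := norm_pos_iff.1 (hρ.trans htρ)
    have hmem : Complex.log t ∈ S := by
      refine ⟨?_, ?_, ?_⟩
      · rw [Complex.log_re]; exact Real.log_lt_log hρ htρ
      · rw [Complex.log_im]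
        exact lt_of_le_of_ne (Complex.arg_nonneg_iff.2 ht.le) fun h => by
          have := (Complex.arg_eq_zero_iff.1 h.symm).2
          exact ht.ne' this
      · rw [Complex.log_im]
        exact lt_of_le_of_ne (Complex.arg_le_pi t) fun h => by
          have := (Complex.arg_eq_pi_iff.1 h).2
          exact ht.ne' this
    have := hEq hmem
    simpa only [Complex.exp_log ht0] using this
  -- A real `t` is reached vertically from the open half-plane; both sides are continuous along this
  -- path.
  have hpath : Tendsto (fun ε : ℝ => t + ε * I) (𝓝[>] 0) (𝓝 t) := by
    have : Tendsto (fun ε : ℝ => t + ε * I) (𝓝 0) (𝓝 (t + (0 : ℝ) * I)) :=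
      Continuous.tendsto (by fun_prop) _
    simp only [ofReal_zero, zero_mul, add_zero] at this
    exact this.mono_left nhdsWithin_le_nhds
  have hl : Tendsto (fun ε : ℝ => G (t + ε * I)) (𝓝[>] 0) (𝓝 (G t)) := by
    refine (continuousOn_halfFourier hint t ht).tendsto.comp
      (tendsto_nhdsWithin_of_tendsto_nhds_of_eventually_within _ hpath ?_)
    filter_upwards [self_mem_nhdsWithin] with ε hε
    have hε : 0 < ε := hε
    simp only [add_im, mul_im, ofReal_re, I_im, mul_one, ofReal_im, I_re, mul_zero,
      add_zero]
    linarith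
  have hr : Tendsto (fun ε : ℝ => b (t + ε * I)⁻¹) (𝓝[>] 0) (𝓝 (b t⁻¹)) :=
    (hinv t htρ).continuousAt.tendsto.comp hpath
  refine tendsto_nhds_unique hl (hr.congr' ?_)
  have hn : ∀ᶠ ε : ℝ in 𝓝[>] 0, ρ < ‖t + ε * I‖ := hpath.norm.eventually (lt_mem_nhds htρ)
  filter_upwards [self_mem_nhdsWithin, hn] with ε hε hε'
  have hε : 0 < ε := hε
  refine (hopen _ ?_ hε').symm
  simp only [add_im, mul_im, ofReal_re, I_im, mul_one, ofReal_im, I_re, mul_zero, add_zero]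
  linarith

/-! ### The Joukowski map and the gluing on the unit disc -/

/-- The inverse Joukowski map `u ↦ 1 / t`, where `t = lam * (u + 1 / u) / 2`. -/
noncomputable def joukowskiInv (lam : ℝ) (u : ℂ) : ℂ := 2 * u / (lam * (1 + u ^ 2))

/-- The Borel transform transported to the closed unit disc by the Joukowski map. -/
noncomputable def discTransform (f : ℂ → ℂ) (lam : ℝ) (u : ℂ) : ℂ :=
  if u.im < 0 then halfFourier (fun x => f x) (lam / 2 * (u + u⁻¹))
  else if 0 < u.im then halfFourier (fun x => f x) (-(lam / 2 * (u + u⁻¹)))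
  else borelSeries (fun n => iteratedDeriv n f 0) (joukowskiInv lam u)

/-- Inside the unit disc the last factor is positive, so `t` and `u` have imaginary parts of
opposite sign; on the unit circle `t` is real. -/
theorem im_joukowski (lam : ℝ) (u : ℂ) :
    (lam / 2 * (u + u⁻¹)).im = lam / 2 * (-u.im) * (1 / normSq u - 1) := by
  have : (lam / 2 : ℂ) = ((lam / 2 : ℝ) : ℂ) := by push_cast; rfl
  rw [this, Complex.im_ofReal_mul, add_im, inv_im]
  ring

theorem joukowski_inv {lam : ℝ} {u : ℂ} (hu : u ≠ 0) :
    (lam / 2 * (u + u⁻¹))⁻¹ = joukowskiInv lam u := by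
  have : (lam / 2 * (u + u⁻¹) : ℂ) = lam * (1 + u ^ 2) / (2 * u) := by
    field_simp
    ring
  rw [this, inv_div, joukowskiInv]

/-- The hypothesis is `|t| > ρ` cleared of denominators. In this form it also makes sense at `u =
0`, where it holds, and at `u = ±i`, where it fails. -/
theorem lt_norm_joukowski {lam ρ : ℝ} (hlam : 0 < lam) {u : ℂ} (hu : u ≠ 0)
    (h : 2 * ρ * ‖u‖ < lam * ‖1 + u ^ 2‖) : ρ < ‖(lam / 2 * (u + u⁻¹) : ℂ)‖ := by
  have : (lam / 2 * (u + u⁻¹) : ℂ) = lam * (1 + u ^ 2) / (2 * u) := by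
    field_simp
    ring
  have hu' := norm_pos_iff.2 hu
  rw [this, norm_div, norm_mul, norm_mul, Complex.norm_real, Real.norm_eq_abs, abs_of_pos hlam,
    Complex.norm_ofNat, lt_div_iff₀ (by positivity)]
  linarith

theorem mul_norm_joukowskiInv_lt_one {lam ρ : ℝ} (hlam : 0 < lam) (hρ : 0 < ρ) {u : ℂ}
    (h : 2 * ρ * ‖u‖ < lam * ‖1 + u ^ 2‖) : ρ * ‖joukowskiInv lam u‖ < 1 := by
  have h0 : 0 < lam * ‖1 + u ^ 2‖ := lt_of_le_of_lt (by positivity) h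
  rw [joukowskiInv, norm_div, norm_mul, norm_mul, Complex.norm_real, Real.norm_eq_abs,
    abs_of_pos hlam, Complex.norm_ofNat, ← mul_div_assoc, div_lt_one h0]
  linarith

section

variable {f : ℂ → ℂ} {lam ρ M : ℝ}

theorem one_div_normSq_sub_one_nonneg {u : ℂ} (hu : ‖u‖ ≤ 1) (h0 : u ≠ 0) :
    0 ≤ 1 / normSq u - 1 := by
  rw [sub_nonneg, le_div_iff₀ (normSq_pos.2 h0), one_mul, normSq_eq_norm_sq]
  exact pow_le_one₀ (norm_nonneg _) hu

/-- Each half-disc branch is evaluated in the closed upper half-plane at `t` or `-t`, and evenness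
of the Borel series removes the sign. All three branches thus agree on a neighbourhood of the
diameter, relative to the closed disc. -/
theorem discTransform_eq_borelSeries (hf : Differentiable ℂ f)
    (hint : IntegrableOn (fun x : ℝ => f x) (Ioi 0))
    (hD : ∀ n, ‖iteratedDeriv n f 0‖ ≤ M * ρ ^ (n + 1))
    (hodd : ∀ n, Even n → iteratedDeriv n f 0 = 0) (hρ : 0 < ρ) (hlam : 0 < lam) {u : ℂ}
    (hu : ‖u‖ ≤ 1) (h : 2 * ρ * ‖u‖ < lam * ‖1 + u ^ 2‖) :
    discTransform f lam u =
      borelSeries (fun n => iteratedDeriv n f 0) (joukowskiInv lam u) := by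
  unfold discTransform
  split_ifs with h1 h2
  · have h0 : u ≠ 0 := by rintro rfl; simp at h1
    rw [halfFourier_eq_borelSeries hf hint hD hρ _ (lt_norm_joukowski hlam h0 h),
      joukowski_inv h0]
    rw [im_joukowski]
    exact mul_nonneg (mul_nonneg (by positivity) (by linarith))
      (one_div_normSq_sub_one_nonneg hu h0)
  · have h0 : u ≠ 0 := by rintro rfl; simp at h2
    rw [halfFourier_eq_borelSeries hf hint hD hρ _ (by
        rw [norm_neg]; exact lt_norm_joukowski hlam h0 h), ← neg_inv, joukowski_inv h0,
      borelSeries_neg hodd]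
    rw [neg_im, im_joukowski]
    have := mul_nonneg (mul_nonneg (show 0 ≤ lam / 2 by positivity) h2.le)
      (one_div_normSq_sub_one_nonneg hu h0)
    linarith
  · rfl

/-- For real `u`, `2|u| ≤ 1 + u²`. This is where `ρ < lam` enters the gluing. -/
theorem two_mul_norm_lt_of_im_eq_zero (hρlam : ρ < lam) (hρ : 0 < ρ) {u : ℂ}
    (h : u.im = 0) : 2 * ρ * ‖u‖ < lam * ‖1 + u ^ 2‖ := by
  have hr : u = (u.re : ℂ) := by apply Complex.ext <;> simp [h]
  rw [hr]
  have : (1 + (u.re : ℂ) ^ 2) = ((1 + u.re ^ 2 : ℝ) : ℂ) := by push_cast; rfl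
  rw [this, Complex.norm_real, Complex.norm_real, Real.norm_eq_abs, Real.norm_eq_abs,
    abs_of_nonneg (by positivity : (0 : ℝ) ≤ 1 + u.re ^ 2), ← sq_abs]
  have h1 : 2 * |u.re| ≤ 1 + |u.re| ^ 2 := by nlinarith [sq_nonneg (|u.re| - 1)]
  have h2 : 0 < 1 + |u.re| ^ 2 := by positivity
  nlinarith

/-- Off the diameter the function is locally a half-line Fourier transform composed with the
Joukowski map, regular inside and continuous up to the circle. Near the diameter, endpoints `±1`
included, it is the Borel series. -/
theorem diffContOnCl_discTransform (hf : Differentiable ℂ f)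
    (hint : IntegrableOn (fun x : ℝ => f x) (Ioi 0))
    (hD : ∀ n, ‖iteratedDeriv n f 0‖ ≤ M * ρ ^ (n + 1))
    (hodd : ∀ n, Even n → iteratedDeriv n f 0 = 0) (hρ : 0 < ρ) (hρlam : ρ < lam) :
    DiffContOnCl ℂ (discTransform f lam) (ball 0 1) := by
  have hlam : 0 < lam := hρ.trans hρlam
  have hDo : IsOpen {u : ℂ | 2 * ρ * ‖u‖ < lam * ‖1 + u ^ 2‖} :=
    isOpen_lt (by fun_prop) (by fun_prop)
  have hVopen : IsOpen {v : ℂ | ρ * ‖v‖ < 1} := isOpen_lt (by fun_prop) continuous_const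
  have hbv : ∀ u : ℂ, 2 * ρ * ‖u‖ < lam * ‖1 + u ^ 2‖ → DifferentiableAt ℂ
      (fun u => borelSeries (fun n => iteratedDeriv n f 0) (joukowskiInv lam u)) u := by
    intro u hu
    refine DifferentiableAt.comp u ((differentiableOn_borelSeries hD hρ).differentiableAt
      (hVopen.mem_nhds (mul_norm_joukowskiInv_lt_one hlam hρ hu))) ?_
    have hne : (lam * (1 + u ^ 2) : ℂ) ≠ 0 := by
      have h0 : 0 < lam * ‖1 + u ^ 2‖ := lt_of_le_of_lt (by positivity) hu
      intro h
      have h' := congrArg norm h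
      rw [norm_mul, Complex.norm_real, Real.norm_eq_abs, abs_of_pos hlam, norm_zero] at h'
      exact h0.ne' h'
    unfold joukowskiInv
    fun_prop (disch := exact hne)
  have hneg : ∀ u : ℂ, u.im < 0 → discTransform f lam =ᶠ[𝓝 u]
      fun u => halfFourier (fun x => f x) (lam / 2 * (u + u⁻¹)) := by
    intro u hu
    filter_upwards [(isOpen_lt continuous_im continuous_const).mem_nhds hu] with w hw
    exact if_pos hw
  have hpos : ∀ u : ℂ, 0 < u.im → discTransform f lam =ᶠ[𝓝 u]
      fun u => halfFourier (fun x => f x) (-(lam / 2 * (u + u⁻¹))) := by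
    intro u hu
    filter_upwards [(isOpen_lt continuous_const continuous_im).mem_nhds hu] with w hw
    have hw : 0 < w.im := hw
    rw [discTransform, if_neg hw.not_gt, if_pos hw]
  have hjd : ∀ u : ℂ, u ≠ 0 → DifferentiableAt ℂ (fun u : ℂ => (lam / 2 * (u + u⁻¹) : ℂ)) u := by
    intro u hu
    fun_prop (disch := exact hu)
  refine ⟨fun u hu => DifferentiableAt.differentiableWithinAt ?_, ?_⟩
  · have hu1 : ‖u‖ < 1 := by simpa using hu
    have hstrict : u ≠ 0 → 0 < 1 / normSq u - 1 := by
      intro h0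
      rw [sub_pos, lt_div_iff₀ (normSq_pos.2 h0), one_mul, normSq_eq_norm_sq]
      exact pow_lt_one₀ (norm_nonneg _) hu1 two_ne_zero
    rcases lt_trichotomy u.im 0 with h | h | h
    · have h0 : u ≠ 0 := by rintro rfl; simp at h
      refine DifferentiableAt.congr_of_eventuallyEq ?_ (hneg u h)
      refine DifferentiableAt.comp u (g := halfFourier fun x => f x)
        (differentiableAt_halfFourier hint ?_) (hjd u h0)
      rw [im_joukowski]
      exact mul_pos (mul_pos (by positivity) (by linarith)) (hstrict h0)
    · have hd := two_mul_norm_lt_of_im_eq_zero hρlam hρ h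
      refine (hbv u hd).congr_of_eventuallyEq ?_
      filter_upwards [hDo.mem_nhds hd, isOpen_ball.mem_nhds hu] with w hw hw1
      have hw1 : ‖w‖ < 1 := by simpa using hw1
      exact discTransform_eq_borelSeries hf hint hD hodd hρ hlam hw1.le hw
    · have h0 : u ≠ 0 := by rintro rfl; simp at h
      refine DifferentiableAt.congr_of_eventuallyEq ?_ (hpos u h)
      refine DifferentiableAt.comp u (g := halfFourier fun x => f x)
        (differentiableAt_halfFourier hint ?_) (hjd u h0).neg
      rw [neg_im, im_joukowski]
      have := mul_pos (mul_pos (show 0 < lam / 2 by positivity) h) (hstrict h0)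
      linarith
  · rw [closure_ball _ one_ne_zero]
    intro u hu
    have hu1 : ‖u‖ ≤ 1 := by simpa using hu
    rcases lt_trichotomy u.im 0 with h | h | h
    · have h0 : u ≠ 0 := by rintro rfl; simp at h
      refine ContinuousWithinAt.congr_of_eventuallyEq ?_
        ((hneg u h).filter_mono nhdsWithin_le_nhds) (hneg u h).self_of_nhds
      refine ((continuousOn_halfFourier hint _ ?_).tendsto.comp
        (tendsto_nhdsWithin_of_tendsto_nhds_of_eventually_within _
          ((hjd u h0).continuousAt.tendsto.mono_left nhdsWithin_le_nhds) ?_))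
      · change 0 ≤ Complex.im _
        rw [im_joukowski]
        exact mul_nonneg (mul_nonneg (by positivity) (by linarith))
          (one_div_normSq_sub_one_nonneg hu1 h0)
      · filter_upwards [self_mem_nhdsWithin, nhdsWithin_le_nhds
          ((isOpen_lt continuous_im continuous_const).mem_nhds h)] with w hw hw'
        have hw' : w.im < 0 := hw'
        change 0 ≤ Complex.im _
        rw [im_joukowski]
        exact mul_nonneg (mul_nonneg (by positivity) (by linarith))
          (one_div_normSq_sub_one_nonneg (by simpa using hw) (by rintro rfl; simp at hw'))
    · have hd := two_mul_norm_lt_of_im_eq_zero hρlam hρ h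
      refine (hbv u hd).continuousAt.continuousWithinAt.congr_of_eventuallyEq ?_
        (discTransform_eq_borelSeries hf hint hD hodd hρ hlam hu1 hd)
      filter_upwards [nhdsWithin_le_nhds (hDo.mem_nhds hd), self_mem_nhdsWithin] with w hw hw1
      exact discTransform_eq_borelSeries hf hint hD hodd hρ hlam (by simpa using hw1) hw
    · have h0 : u ≠ 0 := by rintro rfl; simp at h
      refine ContinuousWithinAt.congr_of_eventuallyEq ?_
        ((hpos u h).filter_mono nhdsWithin_le_nhds) (hpos u h).self_of_nhds
      refine ((continuousOn_halfFourier hint _ ?_).tendsto.comp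
        (tendsto_nhdsWithin_of_tendsto_nhds_of_eventually_within _
          ((hjd u h0).neg.continuousAt.tendsto.mono_left nhdsWithin_le_nhds) ?_))
      · change 0 ≤ Complex.im _
        rw [neg_im, im_joukowski]
        have := mul_nonneg (mul_nonneg (show 0 ≤ lam / 2 by positivity) h.le)
          (one_div_normSq_sub_one_nonneg hu1 h0)
        linarith
      · filter_upwards [self_mem_nhdsWithin, nhdsWithin_le_nhds
          ((isOpen_lt continuous_const continuous_im).mem_nhds h)] with w hw hw'
        have hw' : 0 < w.im := hw'
        change 0 ≤ Complex.im _
        rw [neg_im, im_joukowski]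
        have := mul_nonneg (mul_nonneg (show 0 ≤ lam / 2 by positivity) hw'.le)
          (one_div_normSq_sub_one_nonneg (u := w) (by simpa using hw) (by rintro rfl; simp at hw'))
        linarith

/-! ### Taylor coefficients in the disc coordinate -/

/-- The Taylor coefficient of order `2 * N + 2` of the Borel transform in the disc coordinate. -/
noncomputable def discCoeff (D : ℕ → ℂ) (lam : ℝ) (N : ℕ) : ℂ :=
  ∑ q ∈ Finset.HasAntidiagonal.antidiagonal N, D (2 * q.1 + 1) * (-1) ^ (q.1 + 1) *
    (2 / (lam : ℂ)) ^ (2 * q.1 + 2) * (((q.2 + (2 * q.1 + 1)).choose (2 * q.1 + 1) : ℂ) *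
      (-1) ^ q.2)

/-- Each power of `2u / (λ(1 + u²))` is expanded by the negative binomial series, and the double
series is regrouped by total degree. -/
theorem hasSum_borelSeries_joukowskiInv {D : ℕ → ℂ} (hD : ∀ n, ‖D n‖ ≤ M * ρ ^ (n + 1))
    (hodd : ∀ n, Even n → D n = 0) (hρ : 0 < ρ) (hlam : 0 < lam) {u : ℂ} (hu : ‖u‖ < 1)
    (h : 2 * ρ * ‖u‖ < lam * (1 - ‖u‖ ^ 2)) :
    HasSum (fun N => discCoeff D lam N * u ^ (2 * N + 2))
      (borelSeries D (joukowskiInv lam u)) := by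
  have hu2 : ‖u ^ 2‖ < 1 := by rw [norm_pow]; exact pow_lt_one₀ (norm_nonneg _) hu two_ne_zero
  have hinj : Function.Injective (fun p : ℕ => 2 * p + 1) := fun a b hab => by
    simp only at hab; omega
  have hnotin : ∀ n, n ∉ range (fun p : ℕ => 2 * p + 1) → Even n := by
    intro n hn
    by_contra hne
    obtain ⟨k, hk⟩ := Nat.not_even_iff_odd.1 hne
    exact hn ⟨k, hk.symm⟩
  set F : ℕ × ℕ → ℂ := fun q => D (2 * q.1 + 1) * (-1) ^ (q.1 + 1) *
    (2 / (lam : ℂ)) ^ (2 * q.1 + 2) * (((q.2 + (2 * q.1 + 1)).choose (2 * q.1 + 1) : ℂ) *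
      (-1) ^ q.2) * u ^ (2 * (q.1 + q.2) + 2) with hF
  have hrow : ∀ p, HasSum (fun k => F (p, k))
      (D (2 * p + 1) * (I * joukowskiInv lam u) ^ (2 * p + 1 + 1)) := by
    intro p
    have h1 := (hasSum_choose_mul_geometric_of_norm_lt_one (𝕜 := ℂ) (2 * p + 1) (r := -u ^ 2)
      (by simpa using hu2)).mul_left (D (2 * p + 1) * (-1) ^ (p + 1) *
        (2 / (lam : ℂ)) ^ (2 * p + 2) * u ^ (2 * p + 2))
    have hfun : (fun k => F (p, k)) = fun k => (D (2 * p + 1) * (-1) ^ (p + 1) *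
        (2 / (lam : ℂ)) ^ (2 * p + 2) * u ^ (2 * p + 2)) *
          (((k + (2 * p + 1)).choose (2 * p + 1) : ℂ) * (-u ^ 2) ^ k) := by
      funext k
      rw [neg_pow (u ^ 2)]
      simp only [hF]
      ring
    have hval : D (2 * p + 1) * (I * joukowskiInv lam u) ^ (2 * p + 1 + 1) =
        (D (2 * p + 1) * (-1) ^ (p + 1) *
        (2 / (lam : ℂ)) ^ (2 * p + 2) * u ^ (2 * p + 2)) *
          (1 / (1 - -u ^ 2) ^ (2 * p + 1 + 1)) := by
      have hI : I ^ (2 * p + 1 + 1) = (-1) ^ (p + 1) := by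
        rw [← I_sq, ← pow_mul]; ring_nf
      have hj : joukowskiInv lam u = 2 / (lam : ℂ) * u * (1 / (1 - -u ^ 2)) := by
        rw [joukowskiInv, sub_neg_eq_add, ← div_div]; ring
      rw [mul_pow, hI, hj, mul_pow, mul_pow, one_div_pow]
      ring
    rw [hfun, hval]
    exact h1
  -- Taking norms replaces `1 + u²` by `1 - ‖u‖²`, so the row sums are the norms of Borel terms at
  -- `2‖u‖ / (λ(1 - ‖u‖²))`. The hypothesis `h` puts this point inside the disc of convergence.
  have hnorm : Summable fun q => ‖F q‖ := by
    have hr0 : 0 < 1 - ‖u‖ ^ 2 := by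
      have := pow_lt_one₀ (norm_nonneg _) hu two_ne_zero
      linarith
    have hrown : ∀ p, HasSum (fun k => ‖F (p, k)‖) ‖D (2 * p + 1) *
        (I * ((2 * ‖u‖ / (lam * (1 - ‖u‖ ^ 2)) : ℝ) : ℂ)) ^ (2 * p + 1 + 1)‖ := by
      intro p
      have h1 := (hasSum_choose_mul_geometric_of_norm_lt_one (𝕜 := ℝ) (2 * p + 1)
        (r := ‖u‖ ^ 2) (by simpa using hu2)).mul_left (‖D (2 * p + 1)‖ *
          (2 / lam) ^ (2 * p + 2) * ‖u‖ ^ (2 * p + 2))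
      have hfun : (fun k => ‖F (p, k)‖) = fun k => (‖D (2 * p + 1)‖ *
          (2 / lam) ^ (2 * p + 2) * ‖u‖ ^ (2 * p + 2)) *
          (((k + (2 * p + 1)).choose (2 * p + 1) : ℝ) * (‖u‖ ^ 2) ^ k) := by
        funext k
        simp only [hF, norm_mul, norm_pow, norm_neg, norm_one, one_pow, norm_div,
          Complex.norm_ofNat, Complex.norm_real, Real.norm_eq_abs, abs_of_pos hlam,
          Complex.norm_natCast]
        ring
      have hval : ‖D (2 * p + 1) *
          (I * ((2 * ‖u‖ / (lam * (1 - ‖u‖ ^ 2)) : ℝ) : ℂ)) ^ (2 * p + 1 + 1)‖ =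
          (‖D (2 * p + 1)‖ * (2 / lam) ^ (2 * p + 2) * ‖u‖ ^ (2 * p + 2)) *
          (1 / (1 - ‖u‖ ^ 2) ^ (2 * p + 1 + 1)) := by
        rw [norm_mul, norm_pow, norm_mul, norm_I, one_mul, Complex.norm_real, Real.norm_eq_abs,
          abs_of_nonneg (by positivity), ← div_div, div_pow, mul_div_right_comm, mul_pow]
        ring
      rw [hfun, hval]
      exact h1
    rw [summable_prod_of_nonneg (fun _ => norm_nonneg _)]
    refine ⟨fun p => (hrown p).summable, ?_⟩
    simp_rw [fun p => (hrown p).tsum_eq]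
    refine (summable_norm_borelSeries hD hρ ?_).comp_injective hinj
    rw [Complex.norm_real, Real.norm_eq_abs, abs_of_nonneg (by positivity), ← mul_div_assoc,
      div_lt_one (by positivity)]
    linarith
  have hv : ρ * ‖joukowskiInv lam u‖ < 1 := by
    refine mul_norm_joukowskiInv_lt_one hlam hρ (h.trans_le ?_)
    gcongr
    have := norm_sub_norm_le (1 : ℂ) (-u ^ 2)
    simpa using this
  have hb : HasSum (fun p => D (2 * p + 1) * (I * joukowskiInv lam u) ^ (2 * p + 1 + 1))
      (borelSeries D (joukowskiInv lam u)) := by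
    refine (hinj.hasSum_iff ?_).2 (summable_norm_borelSeries hD hρ hv).of_norm.hasSum
    intro n hn
    rw [hodd n (hnotin n hn), zero_mul]
  have hall : HasSum F (borelSeries D (joukowskiInv lam u)) := by
    have h1 := hnorm.of_norm.hasSum
    rwa [(h1.prod_fiberwise hrow).unique hb] at h1
  have hsig := (Finset.HasAntidiagonal.sigmaAntidiagonalEquivProd (A := ℕ)).hasSum_iff.2 hall
  have hN := hsig.sigma (fun N => hasSum_fintype _)
  have hfun : (fun N => discCoeff D lam N * u ^ (2 * N + 2)) = fun N =>
      ∑ c : Finset.HasAntidiagonal.antidiagonal N,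
        (F ∘ Finset.HasAntidiagonal.sigmaAntidiagonalEquivProd) ⟨N, c⟩ := by
    funext N
    rw [discCoeff, Finset.sum_mul]
    rw [← Finset.sum_coe_sort]
    refine Finset.sum_congr rfl fun q _ => ?_
    have hq := Finset.HasAntidiagonal.mem_antidiagonal.1 q.2
    simp only [Function.comp, hF, Finset.HasAntidiagonal.sigmaAntidiagonalEquivProd_apply]
    rw [hq]
  rw [hfun]
  exact hN

theorem eventually_hasSum_discTransform (hf : Differentiable ℂ f)
    (hint : IntegrableOn (fun x : ℝ => f x) (Ioi 0))
    (hD : ∀ n, ‖iteratedDeriv n f 0‖ ≤ M * ρ ^ (n + 1))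
    (hodd : ∀ n, Even n → iteratedDeriv n f 0 = 0) (hρ : 0 < ρ) (hlam : 0 < lam) :
    ∀ᶠ u in 𝓝 0, HasSum (fun n => Function.extend (fun N => 2 * N + 2)
      (discCoeff (fun n => iteratedDeriv n f 0) lam) 0 n * u ^ n) (discTransform f lam u) := by
  have h1 : ∀ᶠ u : ℂ in 𝓝 0, ‖u‖ < 1 :=
    (isOpen_lt continuous_norm continuous_const).mem_nhds (by simp)
  have h2 : ∀ᶠ u : ℂ in 𝓝 0, 2 * ρ * ‖u‖ < lam * (1 - ‖u‖ ^ 2) :=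
    (isOpen_lt (by fun_prop) (by fun_prop)).mem_nhds (by simpa using hlam)
  filter_upwards [h1, h2] with u hu1 hu2
  rw [discTransform_eq_borelSeries hf hint hD hodd hρ hlam hu1.le]
  · exact hasSum_extend_pow (fun a b hab => by
      have : 2 * a + 2 = 2 * b + 2 := hab
      omega)
      (hasSum_borelSeries_joukowskiInv hD hodd hρ hlam hu1 hu2)
  · refine hu2.trans_le ?_
    gcongr
    have := norm_sub_norm_le (1 : ℂ) (-u ^ 2)
    simpa using this

end

/-! ### Fubini, boundary values and the evaluation of the transform -/

section

variable {f : ℂ → ℂ} {lam ρ M : ℝ}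

theorem integrable_prod_exp_cos (hint : IntegrableOn (fun x : ℝ => f x) (Ioi 0)) (lam : ℝ)
    (n : ℕ) : Integrable (fun p : ℝ × ℝ => f p.1 *
      (cexp (I * (lam * p.1) * Real.cos p.2) * Real.cos (n * p.2)))
      ((volume.restrict (Ioi 0)).prod (volume.restrict (Ioc 0 (2 * Real.pi)))) := by
  have h1 : Integrable (fun p : ℝ × ℝ => f p.1)
      ((volume.restrict (Ioi 0)).prod (volume.restrict (Ioc 0 (2 * Real.pi)))) :=
    Integrable.comp_fst (f := fun x : ℝ => f x) hint _
  refine h1.mul_bdd (c := 1) (Continuous.aestronglyMeasurable (by fun_prop))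
    (Eventually.of_forall fun p => ?_)
  rw [norm_mul]
  have e1 : ‖cexp (I * (lam * p.1) * Real.cos p.2)‖ = 1 := by
    rw [Complex.norm_exp, Real.exp_eq_one_iff, mul_assoc, ← ofReal_mul, ← ofReal_mul]
    simp
  rw [e1, one_mul, Complex.norm_real]
  exact Real.abs_cos_le_one _

/-- Fubini's theorem applied to Bessel's integral. -/
theorem hankelTransform_eq_integral (hint : IntegrableOn (fun x : ℝ => f x) (Ioi 0)) (lam : ℝ)
    (l : ℕ) :
    IntegrableOn (fun x : ℝ => f x * besselJ (2 * l) (lam * x)) (Ioi 0) ∧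
    2 * Real.pi * ((-1) ^ l * hankelTransform (2 * l) f lam) =
      ∫ θ in (0 : ℝ)..2 * Real.pi,
        halfFourier (fun x => f x) ((lam * Real.cos θ : ℝ) : ℂ) * Real.cos ((2 * l : ℕ) * θ) := by
  have hpi : (0 : ℝ) ≤ 2 * Real.pi := by positivity
  have hpi' : (Real.pi : ℂ) ≠ 0 := by exact_mod_cast Real.pi_ne_zero
  have hP := integrable_prod_exp_cos hint lam (2 * l)
  have hI : I ^ (2 * l) = (-1) ^ l := by rw [pow_mul, I_sq]
  have hinner : ∀ x : ℝ, ∫ θ in Ioc 0 (2 * Real.pi), f x *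
      (cexp (I * (lam * x) * Real.cos θ) * Real.cos ((2 * l : ℕ) * θ)) =
        2 * Real.pi * (-1) ^ l * (f x * besselJ (2 * l) (lam * x)) := by
    intro x
    rw [integral_const_mul, ← intervalIntegral.integral_of_le hpi, integral_exp_cos_mul_cos, hI]
    ring
  constructor
  · have h := hP.integral_prod_left
    simp only [hinner] at h
    refine (h.const_mul ((2 * Real.pi * (-1) ^ l : ℂ)⁻¹)).congr (Eventually.of_forall fun x => ?_)
    have : (2 * Real.pi * (-1) ^ l : ℂ) ≠ 0 := by
      refine mul_ne_zero (mul_ne_zero two_ne_zero hpi') (pow_ne_zero _ (by norm_num))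
    simp only
    rw [inv_mul_cancel_left₀ this]
  · have h := integral_integral_swap (f := fun x θ : ℝ => f x *
      (cexp (I * (lam * x) * Real.cos θ) * Real.cos ((2 * l : ℕ) * θ))) hP
    simp only [hinner] at h
    rw [integral_const_mul] at h
    rw [hankelTransform, ← mul_assoc, h, intervalIntegral.integral_of_le hpi]
    congr 1
    funext θ
    rw [halfFourier, ← integral_mul_const]
    congr 1
    funext x
    push_cast
    rw [show I * (lam * x) * Complex.cos θ = I * (lam * Complex.cos θ) * x by ring]
    ring

theorem joukowski_exp (lam θ : ℝ) :
    (lam / 2 * (cexp (θ * I) + (cexp (θ * I))⁻¹) : ℂ) = ((lam * Real.cos θ : ℝ) : ℂ) := by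
  rw [← Complex.exp_neg]
  push_cast
  rw [Complex.cos]
  ring_nf

theorem discTransform_exp_of_mem_Ioo_zero_pi {θ : ℝ} (h : θ ∈ Ioo 0 Real.pi) :
    discTransform f lam (cexp (θ * I)) =
      halfFourier (fun x => f x) ((lam * Real.cos (Real.pi - θ) : ℝ) : ℂ) := by
  have him : (cexp (θ * I)).im = Real.sin θ := Complex.exp_ofReal_mul_I_im θ
  have hpos := Real.sin_pos_of_mem_Ioo h
  rw [discTransform, him, if_neg hpos.not_gt, if_pos hpos, joukowski_exp, Real.cos_pi_sub]
  push_cast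
  ring_nf

theorem discTransform_exp_of_mem_Ioo_pi_two_pi {θ : ℝ} (h : θ ∈ Ioo Real.pi (2 * Real.pi)) :
    discTransform f lam (cexp (θ * I)) =
      halfFourier (fun x => f x) ((lam * Real.cos θ : ℝ) : ℂ) := by
  have him : (cexp (θ * I)).im = Real.sin θ := Complex.exp_ofReal_mul_I_im θ
  have hneg : Real.sin θ < 0 := by
    have := Real.sin_pos_of_mem_Ioo (x := θ - Real.pi) ⟨by linarith [h.1], by linarith [h.2]⟩
    rw [Real.sin_sub_pi] at this
    linarith
  rw [discTransform, him, if_pos hneg, joukowski_exp]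

/-- On the upper arc the boundary value is `G(-λ cos θ)`; reflecting `θ ↦ π - θ` turns it into `G(λ
cos θ)` and leaves `cos(2lθ)` unchanged because the order is even. -/
theorem integral_halfFourier_cos (hf : Differentiable ℂ f)
    (hint : IntegrableOn (fun x : ℝ => f x) (Ioi 0))
    (hD : ∀ n, ‖iteratedDeriv n f 0‖ ≤ M * ρ ^ (n + 1))
    (hodd : ∀ n, Even n → iteratedDeriv n f 0 = 0) (hρ : 0 < ρ) (hρlam : ρ < lam) (l : ℕ) :
    ∫ θ in (0 : ℝ)..2 * Real.pi,
        halfFourier (fun x => f x) ((lam * Real.cos θ : ℝ) : ℂ) * Real.cos ((2 * l : ℕ) * θ) =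
      Real.pi * Function.extend (fun N => 2 * N + 2)
        (discCoeff (fun n => iteratedDeriv n f 0) lam) 0 (2 * l) := by
  have hK := diffContOnCl_discTransform hf hint hD hodd hρ hρlam
  have hc := integral_circle_eq_coeff hK
    (eventually_hasSum_discTransform hf hint hD hodd hρ (hρ.trans hρlam)) (2 * l)
  have h0 : discTransform f lam 0 = 0 := by
    simp [discTransform, joukowskiInv, borelSeries_zero]
  have hz := integral_circle_mul_pow hK (2 * l) h0
  have hKcont : Continuous fun θ : ℝ => discTransform f lam (cexp (θ * I)) := by
    refine hK.continuousOn_ball.comp_continuous (by fun_prop) fun θ => ?_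
    simp [Complex.norm_exp]
  set A : ℝ → ℂ := fun θ => halfFourier (fun x => f x) ((lam * Real.cos θ : ℝ) : ℂ) *
    Real.cos ((2 * l : ℕ) * θ) with hA
  have hAcont : Continuous A := by
    refine Continuous.mul ?_ (by fun_prop)
    exact (continuousOn_halfFourier hint).comp_continuous (by fun_prop) fun θ => (ofReal_im _).ge
  set B : ℝ → ℂ := fun θ => discTransform f lam (cexp (θ * I)) * Real.cos ((2 * l : ℕ) * θ)
    with hB
  have hBcont : Continuous B := by fun_prop
  have hBint : 2 * ∫ θ in (0 : ℝ)..2 * Real.pi, B θ =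
      2 * Real.pi * Function.extend (fun N => 2 * N + 2)
        (discCoeff (fun n => iteratedDeriv n f 0) lam) 0 (2 * l) := by
    -- The first exponential extracts the Taylor coefficient; the second integrates to zero by the
    -- mean value property.
    have hsplit : ∀ θ : ℝ, 2 * B θ =
        discTransform f lam (cexp (θ * I)) * cexp (-((2 * l : ℕ) * θ * I)) +
          discTransform f lam (cexp (θ * I)) * cexp ((2 * l : ℕ) * θ * I) := by
      intro θ
      simp only [hB]
      rw [Complex.ofReal_cos ((2 * l : ℕ) * θ), Complex.cos]
      push_cast
      ring_nf
    rw [← intervalIntegral.integral_const_mul]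
    simp_rw [hsplit]
    rw [intervalIntegral.integral_add, hc, hz, add_zero]
    all_goals exact Continuous.intervalIntegrable (by fun_prop) _ _
  have hpi := Real.pi_pos
  have hA1 : ∫ θ in Real.pi..2 * Real.pi, A θ = ∫ θ in (0 : ℝ)..Real.pi, A θ := by
    have h := integral_comp_two_pi_sub A 0 Real.pi
    rw [sub_zero, show 2 * Real.pi - Real.pi = Real.pi by ring] at h
    rw [← h]
    congr 1
    funext θ
    simp only [hA]
    rw [Real.cos_two_pi_sub, mul_sub,
      Real.cos_nat_mul_two_pi_sub]
  have hB1 : ∫ θ in (0 : ℝ)..Real.pi, B θ = ∫ θ in (0 : ℝ)..Real.pi, A θ := by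
    have h := intervalIntegral.integral_comp_sub_left A (a := 0) (b := Real.pi) Real.pi
    rw [sub_zero, sub_self] at h
    rw [← h]
    refine intervalIntegral.integral_congr_Ioo_of_le hpi.le fun θ hθ => ?_
    simp only [hA, hB]
    rw [discTransform_exp_of_mem_Ioo_zero_pi hθ, mul_sub,
      show ((2 * l : ℕ) : ℝ) * Real.pi = l * (2 * Real.pi) by push_cast; ring,
      Real.cos_nat_mul_two_pi_sub]
  have hB2 : ∫ θ in Real.pi..2 * Real.pi, B θ = ∫ θ in Real.pi..2 * Real.pi, A θ := by
    refine intervalIntegral.integral_congr_Ioo_of_le (by linarith) fun θ hθ => ?_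
    simp only [hA, hB]
    rw [discTransform_exp_of_mem_Ioo_pi_two_pi hθ]
  have hBA : ∫ θ in (0 : ℝ)..2 * Real.pi, B θ = ∫ θ in (0 : ℝ)..2 * Real.pi, A θ := by
    rw [← intervalIntegral.integral_add_adjacent_intervals (b := Real.pi)
      (hBcont.intervalIntegrable _ _) (hBcont.intervalIntegrable _ _), hB1, hB2,
      intervalIntegral.integral_add_adjacent_intervals
      (hAcont.intervalIntegrable _ _) (hAcont.intervalIntegrable _ _)]
  rw [← hBA]
  linear_combination hBint / 2

/-- With `N = p + k` the signs have total exponent `2(p + k + 1)` and cancel. The outer sign is the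
`(-1)^l` of Bessel's integral at `l = N + 1`. -/
theorem sum_antidiagonal_discCoeff (D : ℕ → ℂ) (lam : ℝ) (N : ℕ) :
    (-1) ^ (N + 1) * discCoeff D lam N = ∑ p ∈ Finset.range (N + 1),
      D (2 * p + 1) / ((2 * p + 1).factorial : ℂ) *
        (((N + 1 + p).factorial : ℂ) / ((N - p).factorial : ℂ)) *
          (2 / (lam : ℂ)) ^ (2 * p + 2) := by
  rw [discCoeff, Finset.Nat.sum_antidiagonal_eq_sum_range_succ_mk, Finset.mul_sum]
  refine Finset.sum_congr rfl fun p hp => ?_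
  have hp : p ≤ N := Nat.lt_succ_iff.1 (Finset.mem_range.1 hp)
  obtain ⟨k, rfl⟩ := Nat.exists_eq_add_of_le hp
  simp only [Nat.add_sub_cancel_left]
  have hch : ((k + (2 * p + 1)).choose (2 * p + 1) : ℂ) =
      ((p + k + 1 + p).factorial : ℂ) / ((2 * p + 1).factorial * k.factorial) := by
    rw [Nat.cast_choose ℂ (by omega), Nat.add_sub_cancel,
      show k + (2 * p + 1) = p + k + 1 + p by ring]
  have hs : ((-1) ^ (p + k + 1) * ((-1) ^ (p + 1) * (-1) ^ k) : ℂ) = 1 := by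
    rw [← pow_add, ← pow_add]
    exact Even.neg_one_pow ⟨p + k + 1, by ring⟩
  rw [hch]
  calc _ = ((-1) ^ (p + k + 1) * ((-1) ^ (p + 1) * (-1) ^ k) : ℂ) * (D (2 * p + 1) *
        (2 / (lam : ℂ)) ^ (2 * p + 2) *
          (((p + k + 1 + p).factorial : ℂ) / ((2 * p + 1).factorial * k.factorial))) := by ring
    _ = _ := by
      rw [hs, ← div_div]
      ring

/-- The Hankel transform of even order of an odd entire function whose exponential type is
smaller than the parameter. -/
theorem hankelTransform_eq_sum (hf : Differentiable ℂ f)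
    (hint : IntegrableOn (fun x : ℝ => f x) (Ioi 0))
    (hD : ∀ n, ‖iteratedDeriv n f 0‖ ≤ M * ρ ^ (n + 1))
    (hodd : ∀ n, Even n → iteratedDeriv n f 0 = 0) (hρ : 0 < ρ) (hρlam : ρ < lam) (l : ℕ) :
    hankelTransform (2 * l) f lam = (1 / 2) * ∑ p ∈ Finset.range l,
      iteratedDeriv (2 * p + 1) f 0 / ((2 * p + 1).factorial : ℂ) *
        (((l + p).factorial : ℂ) / ((l - p - 1).factorial : ℂ)) *
          (2 / (lam : ℂ)) ^ (2 * p + 2) := by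
  have h1 := integral_halfFourier_cos hf hint hD hodd hρ hρlam l
  rw [← (hankelTransform_eq_integral hint lam l).2] at h1
  have hpi : (Real.pi : ℂ) ≠ 0 := by exact_mod_cast Real.pi_ne_zero
  have h2 : hankelTransform (2 * l) f lam = (1 / 2) * ((-1) ^ l *
      Function.extend (fun N => 2 * N + 2)
        (discCoeff (fun n => iteratedDeriv n f 0) lam) 0 (2 * l)) := by
    have hs : ((-1) ^ l * (-1) ^ l : ℂ) = 1 := by rw [← mul_pow]; simp
    refine mul_left_cancel₀ (mul_ne_zero two_ne_zero hpi) ?_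
    linear_combination (-1) ^ l * h1 - 2 * Real.pi * hankelTransform (2 * l) f lam * hs
  rw [h2]
  congr 1
  -- Only the orders `2N + 2` carry coefficients: order `0` gives zero, and order `2l` with `l > 0`
  -- corresponds to `N = l - 1`.
  cases l with
  | zero =>
    rw [Function.extend_apply']
    · simp
    · rintro ⟨N, hN⟩
      simp at hN
  | succ N =>
    have hinj : Function.Injective fun N => 2 * N + 2 := fun a b hab => by
      have : 2 * a + 2 = 2 * b + 2 := hab
      omega
    have h3 := hinj.extend_apply (discCoeff (fun n => iteratedDeriv n f 0) lam) 0 N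
    rw [show 2 * (N + 1) = 2 * N + 2 by ring, h3, sum_antidiagonal_discCoeff]
    refine Finset.sum_congr rfl fun p _ => ?_
    rw [show N + 1 - p - 1 = N - p by omega]

end

/-! ### Growth bounds, Poincaré terms and the theorem -/

theorem iteratedDeriv_zero_eq_of_hasSum {f : ℂ → ℂ} (hf : Differentiable ℂ f) {c : ℕ → ℂ}
    (hc : ∀ z, HasSum (fun n => c n * z ^ n) (f z)) (n : ℕ) :
    iteratedDeriv n f 0 / (n.factorial : ℂ) = c n := by
  refine congrFun (coeff_eq_of_eventually_hasSum (F := f)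
    (c := fun n => iteratedDeriv n f 0 / (n.factorial : ℂ)) (d := c)
    (Eventually.of_forall fun z => ?_) (Eventually.of_forall hc)) n
  have h := Complex.hasSum_taylorSeries_of_entire hf 0 z
  have hfun : (fun n => iteratedDeriv n f 0 / (n.factorial : ℂ) * z ^ n) =
      fun n : ℕ => (n.factorial : ℂ)⁻¹ • (z - 0) ^ n • iteratedDeriv n f 0 := by
    funext n
    simp only [smul_eq_mul, sub_zero]
    ring
  rw [hfun]
  exact h

/-- An entire function of exponential type satisfies a global exponential bound. -/
theorem IsEntireOfExpType.exists_bound {f : ℂ → ℂ} {τ σ : ℝ} (hf : IsEntireOfExpType f τ)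
    (h : τ < σ) : ∃ C : ℝ, ∀ z, ‖f z‖ ≤ C * Real.exp (σ * ‖z‖) := by
  obtain ⟨R, hR⟩ := hf.2 (σ - τ) (sub_pos.2 h)
  obtain ⟨C, hC⟩ := (isCompact_closedBall (0 : ℂ) R).exists_bound_of_continuousOn
    (f := fun z => f z * (Real.exp (-(σ * ‖z‖)) : ℂ))
    (Continuous.continuousOn (hf.1.continuous.mul (by fun_prop)))
  refine ⟨max C 1, fun z => ?_⟩
  have hpos := Real.exp_pos (σ * ‖z‖)
  rcases le_total R ‖z‖ with hz | hz
  · have h1 := hR z hz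
    rw [add_sub_cancel] at h1
    nlinarith [le_max_right C 1]
  · have h1 := hC z (by simpa using hz)
    rw [norm_mul, Complex.norm_real, Real.norm_eq_abs, abs_of_pos (Real.exp_pos _),
      Real.exp_neg, ← div_eq_mul_inv, div_le_iff₀ hpos] at h1
    exact h1.trans (by gcongr; exact le_max_left _ _)

/-- An entire function of negative exponential type vanishes. -/
theorem IsEntireOfExpType.eq_zero {f : ℂ → ℂ} {τ : ℝ} (hf : IsEntireOfExpType f τ) (h : τ < 0) :
    f = 0 := by
  obtain ⟨C, hC⟩ := hf.exists_bound (σ := τ / 2) (by linarith)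
  have hlim : Tendsto (fun x : ℝ => C * Real.exp (τ / 2 * x)) atTop (𝓝 0) := by
    have : Tendsto (fun x : ℝ => τ / 2 * x) atTop atBot :=
      tendsto_id.const_mul_atTop_of_neg (by linarith)
    simpa using (Real.tendsto_exp_atBot.comp this).const_mul C
  have hlim' : Tendsto f (cocompact ℂ) (𝓝 0) :=
    squeeze_zero_norm hC (hlim.comp tendsto_norm_cocompact_atTop)
  funext z
  exact hf.1.apply_eq_of_tendsto_cocompact z hlim'

theorem poincareTerm_eq_zero_of_iteratedDeriv {f : ℂ → ℂ} (n : ℕ) (lam : ℝ) {s : ℕ}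
    (h : iteratedDeriv s f 0 = 0) : poincareTerm n f lam s = 0 := by
  simp [poincareTerm, h]

/-- The Gamma arguments are the positive integers `l + p + 1` and `l - p`. -/
theorem poincareTerm_odd {f : ℂ → ℂ} (lam : ℝ) {l p : ℕ} (hp : p < l) :
    poincareTerm (2 * l) f lam (2 * p + 1) = (1 / 2) *
      (iteratedDeriv (2 * p + 1) f 0 / ((2 * p + 1).factorial : ℂ) *
        (((l + p).factorial : ℂ) / ((l - p - 1).factorial : ℂ)) *
          (2 / (lam : ℂ)) ^ (2 * p + 2)) := by
  obtain ⟨k, rfl⟩ := Nat.exists_eq_add_of_lt hp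
  have h1 : ((((2 * (p + k + 1) : ℕ) : ℝ) + (2 * p + 1 : ℕ) + 1) / 2) =
      ((p + k + 1 + p : ℕ) : ℝ) + 1 := by push_cast; ring
  have h2 : ((((2 * (p + k + 1) : ℕ) : ℝ) - (2 * p + 1 : ℕ) + 1) / 2) = (k : ℝ) + 1 := by
    push_cast; ring
  rw [poincareTerm, h1, h2, Real.Gamma_nat_eq_factorial, Real.Gamma_nat_eq_factorial,
    show p + k + 1 - p - 1 = k by omega]
  push_cast
  ring

/-- The lower Gamma argument `l - p` is a pole; there `Real.Gamma` takes the value `0`, and division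
by zero yields `0`, in agreement with `1/Γ = 0`. -/
theorem poincareTerm_odd_of_le {f : ℂ → ℂ} (lam : ℝ) {l p : ℕ} (hp : l ≤ p) :
    poincareTerm (2 * l) f lam (2 * p + 1) = 0 := by
  obtain ⟨k, rfl⟩ := Nat.exists_eq_add_of_le hp
  have h2 : ((((2 * l : ℕ) : ℝ) - (2 * (l + k) + 1 : ℕ) + 1) / 2) = -(k : ℝ) := by
    push_cast; ring
  rw [poincareTerm, h2, Real.Gamma_neg_nat_eq_zero]
  simp

theorem sum_range_two_mul_of_even_eq_zero {u : ℕ → ℂ} (hu : ∀ n, Even n → u n = 0) (l : ℕ) :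
    ∑ s ∈ Finset.range (2 * l), u s = ∑ p ∈ Finset.range l, u (2 * p + 1) := by
  induction l with
  | zero => simp
  | succ l ih =>
    rw [show 2 * (l + 1) = 2 * l + 1 + 1 by ring, Finset.sum_range_succ, Finset.sum_range_succ,
      Finset.sum_range_succ, ih, hu (2 * l) (even_two_mul l), add_zero]

theorem theorem1 (f : ℂ → ℂ) (τ lam : ℝ) (m l : ℕ) (a : ℕ → ℂ)
    (hf : IsEntireOfExpType f τ)
    (hint : MeasureTheory.IntegrableOn (fun x : ℝ => f (x : ℂ)) (Set.Ici 0))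
    (hexp : ∀ z : ℂ, ∃ S : ℂ,
      HasSum (fun j : ℕ => a j * z ^ (2 * j)) S ∧ f z = z ^ (2 * m + 1) * S)
    (ha : a 0 ≠ 0)
    (hlam : τ < lam) :
    MeasureTheory.IntegrableOn
        (fun x : ℝ => f (x : ℂ) * besselJ (2 * l) ((lam : ℂ) * (x : ℂ))) (Set.Ioi 0) ∧
    (l < m + 1 → hankelTransform (2 * l) f lam = 0) ∧
    (m + 1 ≤ l → hankelTransform (2 * l) f lam =
        (1 / 2) * ∑ j ∈ Finset.range (l - m),
          a j * (((l + m + j).factorial : ℂ) / ((l - m - j - 1).factorial : ℂ)) *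
            (2 / (lam : ℂ)) ^ (2 * m + 2 * j + 2)) ∧
    ((∀ s : ℕ, 2 * l ≤ s → poincareTerm (2 * l) f lam s = 0) ∧
      hankelTransform (2 * l) f lam =
        ∑ s ∈ Finset.range (2 * l), poincareTerm (2 * l) f lam s) := by
  have hint' : IntegrableOn (fun x : ℝ => f x) (Ioi 0) := hint.mono_set Ioi_subset_Ici_self
  have hinj : Function.Injective fun j => 2 * (m + j) + 1 := fun i j hij => by
    have : 2 * (m + i) + 1 = 2 * (m + j) + 1 := hij
    omega
  have hcoef := iteratedDeriv_zero_eq_of_hasSum hf.1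
    (c := Function.extend (fun j => 2 * (m + j) + 1) a 0) (fun z => by
      refine hasSum_extend_pow hinj ?_
      obtain ⟨S, hS, hfz⟩ := hexp z
      have h := hS.mul_left (z ^ (2 * m + 1))
      rw [← hfz] at h
      have hfun : (fun j => a j * z ^ (2 * (m + j) + 1)) =
          fun j => z ^ (2 * m + 1) * (a j * z ^ (2 * j)) := by
        funext j
        ring
      rw [hfun]
      exact h)
  have hcoef_a : ∀ j, iteratedDeriv (2 * (m + j) + 1) f 0 /
      ((2 * (m + j) + 1).factorial : ℂ) = a j := fun j => by
    rw [hcoef]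
    exact hinj.extend_apply a 0 j
  have hcoef_zero : ∀ n, (∀ j, 2 * (m + j) + 1 ≠ n) → iteratedDeriv n f 0 = 0 := fun n hn => by
    have h := hcoef n
    rw [Function.extend_apply' _ _ _ (by rintro ⟨j, hj⟩; exact hn j hj), Pi.zero_apply,
      div_eq_zero_iff] at h
    exact h.resolve_right (by exact_mod_cast n.factorial_ne_zero)
  have hodd : ∀ n, Even n → iteratedDeriv n f 0 = 0 := fun n hn =>
    hcoef_zero n fun j hj => by
      rw [← hj] at hn
      exact Nat.not_even_iff_odd.2 ⟨m + j, rfl⟩ hn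
  -- If `lam ≤ 0`, then `τ < 0` and `f` vanishes identically, contradicting `a 0 ≠ 0`.
  have hlam0 : 0 < lam := by
    by_contra hneg
    have hzero := hf.eq_zero (by linarith)
    refine ha ?_
    rw [← hcoef_a 0, hzero]
    simp
  -- Two intermediate rates are needed: `σ > τ` for a global growth bound, and `ρ > σ` for the
  -- derivative estimate, with `ρ < lam` left for the gluing.
  obtain ⟨σ, hσ1, hσ2⟩ := exists_between (max_lt hlam hlam0)
  obtain ⟨ρ, hρ1, hρ2⟩ := exists_between hσ2
  have hρ0 : 0 < ρ := ((le_max_right _ _).trans_lt hσ1).trans hρ1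
  obtain ⟨C, hC⟩ := hf.exists_bound ((le_max_left _ _).trans_lt hσ1)
  have hmain := hankelTransform_eq_sum hf.1 hint'
    (norm_iteratedDeriv_zero_le hf.1 hC hρ1 hρ0) hodd hρ0 hρ2 l
  have hsmall : ∀ p, p < m → iteratedDeriv (2 * p + 1) f 0 = 0 := fun p hp =>
    hcoef_zero _ fun j hj => by omega
  refine ⟨(hankelTransform_eq_integral hint' lam l).1, fun hl => ?_, fun hl => ?_,
    fun s hs => ?_, ?_⟩
  · rw [hmain, Finset.sum_eq_zero, mul_zero]
    intro p hp
    rw [hsmall p (by have := Finset.mem_range.1 hp; omega)]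
    simp
  · rw [hmain]
    congr 1
    -- The terms `p < m` vanish by the zero of order `2m + 1` at the origin; the rest are reindexed
    -- by `p = m + j`.
    obtain ⟨k, rfl⟩ := Nat.exists_eq_add_of_le (show m ≤ l by omega)
    rw [Finset.sum_range_add, Finset.sum_eq_zero, zero_add, Nat.add_sub_cancel_left]
    · refine Finset.sum_congr rfl fun j _ => ?_
      rw [hcoef_a j, show m + k - (m + j) - 1 = k - j - 1 by omega,
        show m + k + (m + j) = m + k + m + j by ring,
        show 2 * (m + j) + 2 = 2 * m + 2 * j + 2 by ring]
    · intro p hp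
      rw [hsmall p (Finset.mem_range.1 hp)]
      simp
  · rcases Nat.even_or_odd' s with ⟨p, rfl | rfl⟩
    · exact poincareTerm_eq_zero_of_iteratedDeriv _ _ (hodd _ (even_two_mul p))
    · exact poincareTerm_odd_of_le lam (by omega)
  · rw [hmain, sum_range_two_mul_of_even_eq_zero
      (fun n hn => poincareTerm_eq_zero_of_iteratedDeriv _ _ (hodd n hn)), Finset.mul_sum]
    exact Finset.sum_congr rfl fun p hp => (poincareTerm_odd lam (Finset.mem_range.1 hp)).symm
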